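/- Rings are associative with $1\neq 0$. A submonoid $S\ni 1$ of the multiplicative monoid of a ring $B$ with $0\notin S$ is a \emph{left denominator set} if (i) for all $r\in B$, $s\in S$ one has $Sr\cap Bs\neq\emptyset$, and (ii) $rs=0$ with $r\in B$, $s\in S$ implies $tr=0$ for some $t\in S$. Then $\mathrm{ass}(S)=\{r\in B: sr=0\text{ for some } s\in S\}$ is an ideal, and $S^{-1}B$ denotes the left localization. Let $\mathrm{maxDen}_l(B)$ be the set of left denominator sets that are maximal with respect to inclusion, let $\mathfrak l_B=\bigcap_{S\in \mathrm{maxDen}_l(B)}\mathrm{ass}(S)$, let $T_l(B)$ be the largest left denominator set contained in $\bigcap_{S\in\mathrm{maxDen}_l(B)}S$, and put $\mathfrak l^s_B=\mathrm{ass}(T_l(B))$ and $Q^s_l(B)=T_l(B)^{-1}B$. Let $A$ be a ring whose set $\mathcal C_A$ of regular elements is a left Ore set (i.e. satisfies (i)) and whose classical left quotient ring $R=\mathcal C_A^{-1}A$ is left Artinian; regard $A$ as a subring of $R$. Write $R/\mathrm{rad}(R)=\prod_{i=1}^s \bar R_i$ as a product of simple Artinian rings, where $\mathrm{rad}(R)$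 is the Jacobson radical, let $1=1_1+\dots+1_s$ be any decomposition of $1$ into pairwise orthogonal idempotents of $R$ such that $1_i$ lifts the identity element of $\bar R_i$, and for nonempty $I\subseteq\{1,\dots,s\}$ put $e_I=\sum_{i\in I}1_i$. Let $\mathcal I'_l$ be the set of all $e_I$ with $e_IR(1-e_I)=0$, ordered by $e_I\le e_J$ if $I\subseteq J$, let $\min\mathcal I'_l$ be the set of its minimal elements, and $e=\sum_{e'\in\min\mathcal I'_l}e'$. (The subsets $(1-e)R$ and $(1-e')R$, $e'\in\min \mathcal I'_l$, are two-sided ideals of $R$.) Then: 1. $T_l(A)=\bigcap_{S'\in\mathrm{maxDen}_l(A)}S'=A\cap\bigcap_{S\in\mathrm{maxDen}_l(R)}S$. 2. $\mathfrak l^s_A=A\cap\mathfrak l^s_R=A\cap\mathfrak l_R=A\cap(1-e)R$. 3. $Q_l^s(A)\simeq Q_l^s(R)\simeq R/\mathfrak l^s_R\simeq R/(1-e)R\simeq\prod_{e'\in\min\mathcal I'_l}R/(1-e')R\simeq\prod_{S\in\mathrm{maxDen}_l(R)}S^{-1}R\simeq\prod_{S'\in\mathrm{maxDen}_l(A)}S'^{-1}A$,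 where all the isomorphisms are ring isomorphisms that commute with the canonical homomorphisms from $A$ (and from $R$, for those between rings that receive a canonical homomorphism from $R$). -/

import Mathlib

universe u

namespace StrongLoc

open OreLocalization

section Basic

variable {R : Type u} [Ring R]

/-- Left Ore sets: multiplicative sets (`1 ∈ S`, `0 ∉ S`) such that `S r ∩ R s ≠ ∅` for all
`r ∈ R` and `s ∈ S`. -/
def IsLeftOre (S : Submonoid R) : Prop :=
  (0 : R) ∉ S ∧ ∀ r : R, ∀ s ∈ S, ∃ t ∈ S, ∃ q : R, t * r = q * s

/-- Left denominator sets: left Ore sets `S` such that `r s = 0` with `s ∈ S` implies `t r = 0` for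
some `t ∈ S`. -/
def IsLeftDen (S : Submonoid R) : Prop :=
  IsLeftOre S ∧ ∀ r : R, ∀ s ∈ S, r * s = 0 → ∃ t ∈ S, t * r = 0

theorem IsLeftDen.nonempty_oreSet {S : Submonoid R} (h : IsLeftDen S) : Nonempty (OreSet S) := by
  rw [nonempty_oreSet_iff]
  refine ⟨fun r₁ r₂ s hs => ?_, fun r s => ?_⟩
  · obtain ⟨t, ht, h0⟩ := h.2 (r₁ - r₂) s s.2 (by rw [sub_mul, hs, sub_self])
    exact ⟨⟨t, ht⟩, by rwa [mul_sub, sub_eq_zero] at h0⟩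
  · obtain ⟨t, ht, q, hq⟩ := h.1.2 r s s.2
    exact ⟨q, ⟨t, ht⟩, hq⟩

/-- The data needed by Mathlib in order to localize at a left denominator set. -/
@[reducible] noncomputable def IsLeftDen.oreSet {S : Submonoid R} (h : IsLeftDen S) : OreSet S :=
  h.nonempty_oreSet.some

/-- The left localization `S⁻¹R` at a left denominator set `S` (Mathlib's `OreLocalization`). -/
def LeftLocalization (S : Submonoid R) (h : IsLeftDen S) : Type u :=
  letI := h.oreSet
  OreLocalization S R

noncomputable instance (S : Submonoid R) (h : IsLeftDen S) : Ring (LeftLocalization S h) :=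
  letI := h.oreSet
  inferInstanceAs (Ring (OreLocalization S R))

instance (S : Submonoid R) (h : IsLeftDen S) : Nontrivial (LeftLocalization S h) :=
  letI := h.oreSet
  (OreLocalization.nontrivial_iff (R := R) (S := S)).2 h.1.1

/-- The canonical ring homomorphism `R → S⁻¹R`, `r ↦ 1⁻¹ r`. -/
noncomputable def toLocalization (S : Submonoid R) (h : IsLeftDen S) : R →+* LeftLocalization S h :=
  letI := h.oreSet
  (OreLocalization.numeratorRingHom : R →+* OreLocalization S R)

/-- `ass(S) = {r | s r = 0 for some s ∈ S}`, for a left denominator set `S`. -/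
def ass (S : Submonoid R) (h : IsLeftDen S) : Ideal R where
  carrier := {r | ∃ s ∈ S, s * r = 0}
  zero_mem' := ⟨1, S.one_mem, by simp⟩
  add_mem' := by
    rintro a b ⟨s, hs, ha⟩ ⟨t, ht, hb⟩
    obtain ⟨t', ht', q, hq⟩ := h.1.2 t s hs
    refine ⟨t' * t, S.mul_mem ht' ht, ?_⟩
    rw [mul_add, mul_assoc t' t b, hb, hq, mul_assoc, ha]
    simp
  smul_mem' := by
    rintro c a ⟨s, hs, ha⟩
    obtain ⟨t, ht, q, hq⟩ := h.1.2 c s hs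
    exact ⟨t, ht, by rw [smul_eq_mul, ← mul_assoc, hq, mul_assoc, ha, mul_zero]⟩

instance (S : Submonoid R) (h : IsLeftDen S) : (ass S h).IsTwoSided :=
  ⟨by
    rintro a b ⟨s, hs, ha⟩
    exact ⟨s, hs, by rw [← mul_assoc, ha, zero_mul]⟩⟩

variable (R)

/-- The set of maximal left denominator sets. -/
def maxDen : Set (Submonoid R) := {S | Maximal IsLeftDen S}

/-- The intersection of all the maximal left denominator sets: the strongly left localizable
elements. -/
def stronglyLocalizable : Set R := ⋂ S ∈ maxDen R, (S : Set R)

/-- The left localization radical: the intersection of the ideals `ass(S)`, where `S` runs through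
the maximal left denominator sets. -/
def localizationRadical : Set R := ⋂ S : maxDen R, (ass S.1 S.2.prop : Set R)

/-- The set `T_l(R)`, constructed as the join of all left denominator sets that consist of strongly
left localizable elements. It is the largest left denominator set that consists of such elements,
see `isGreatest_strongDen`. -/
def strongDen : Submonoid R :=
  sSup {S : Submonoid R | IsLeftDen S ∧ (S : Set R) ⊆ stronglyLocalizable R}

variable {R}

theorem exists_le_maxDen {S : Submonoid R} (hS : IsLeftDen S) : ∃ M ∈ maxDen R, S ≤ M := by
  obtain ⟨M, hSM, hM⟩ := zorn_le_nonempty₀ {S : Submonoid R | IsLeftDen S} (by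
    intro c hc hchain T hT
    have hne : c.Nonempty := ⟨T, hT⟩
    have hdir : DirectedOn (· ≤ ·) c := hchain.directedOn
    have hmem : ∀ {x : R}, x ∈ sSup c ↔ ∃ U ∈ c, x ∈ U :=
      Submonoid.mem_sSup_of_directedOn hne hdir
    refine ⟨sSup c, ⟨⟨?_, ?_⟩, ?_⟩, fun U hU => le_sSup hU⟩
    · rw [hmem]
      rintro ⟨U, hU, h0⟩
      exact (hc hU).1.1 h0
    · intro r s hs
      obtain ⟨U, hU, hsU⟩ := hmem.1 hs
      obtain ⟨t, ht, q, hq⟩ := (hc hU).1.2 r s hsU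
      exact ⟨t, hmem.2 ⟨U, hU, ht⟩, q, hq⟩
    · intro r s hs h0
      obtain ⟨U, hU, hsU⟩ := hmem.1 hs
      obtain ⟨t, ht, hq⟩ := (hc hU).2 r s hsU h0
      exact ⟨t, hmem.2 ⟨U, hU, ht⟩, hq⟩) S hS
  exact ⟨M, hM, hSM⟩

theorem isLeftDen_bot [Nontrivial R] : IsLeftDen (⊥ : Submonoid R) := by
  refine ⟨⟨by simp [Submonoid.mem_bot], ?_⟩, ?_⟩
  · intro r s hs
    exact ⟨1, Submonoid.one_mem _, r, by rw [Submonoid.mem_bot.1 hs]; simp⟩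
  · intro r s hs h0
    exact ⟨1, Submonoid.one_mem _, by rw [Submonoid.mem_bot.1 hs] at h0; simpa using h0⟩

theorem strongDen_subset : (strongDen R : Set R) ⊆ stronglyLocalizable R := by
  intro x hx
  refine Set.mem_iInter₂.2 fun M hM => ?_
  have : strongDen R ≤ M := sSup_le fun S hS y hy => Set.mem_iInter₂.1 (hS.2 hy) M hM
  exact this hx

theorem isLeftDen_strongDen [Nontrivial R] : IsLeftDen (strongDen R) := by
  obtain ⟨M, hM, -⟩ := exists_le_maxDen (isLeftDen_bot (R := R))
  refine ⟨⟨fun h0 => hM.prop.1.1 (Set.mem_iInter₂.1 (strongDen_subset h0) M hM), ?_⟩, ?_⟩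
  · intro r s hs
    have hs' := hs
    rw [strongDen, sSup_eq_iSup', Submonoid.iSup_eq_closure] at hs'
    induction hs' using Submonoid.closure_induction generalizing r with
    | mem x hx =>
      obtain ⟨S, hxS⟩ := Set.mem_iUnion.1 hx
      obtain ⟨t, ht, q, hq⟩ := S.2.1.1.2 r x hxS
      exact ⟨t, le_sSup S.2 ht, q, hq⟩
    | one => exact ⟨1, Submonoid.one_mem _, r, by simp⟩
    | mul x y hx hy ihx ihy =>
      have e : Submonoid.closure (⋃ S : {S : Submonoid R | IsLeftDen S ∧
          (S : Set R) ⊆ stronglyLocalizable R}, ((S : Submonoid R) : Set R)) = strongDen R := by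
        rw [strongDen, sSup_eq_iSup', Submonoid.iSup_eq_closure]
      obtain ⟨t, ht, q, hq⟩ := ihy r (e ▸ hy)
      obtain ⟨t', ht', q', hq'⟩ := ihx q (e ▸ hx)
      exact ⟨t' * t, Submonoid.mul_mem _ ht' ht, q', by
        rw [mul_assoc, hq, ← mul_assoc, hq', mul_assoc]⟩
  · intro r s hs
    have hs' := hs
    rw [strongDen, sSup_eq_iSup', Submonoid.iSup_eq_closure] at hs'
    induction hs' using Submonoid.closure_induction generalizing r with
    | mem x hx =>
      intro h0
      obtain ⟨S, hxS⟩ := Set.mem_iUnion.1 hx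
      obtain ⟨t, ht, hq⟩ := S.2.1.2 r x hxS h0
      exact ⟨t, le_sSup S.2 ht, hq⟩
    | one => exact fun h0 => ⟨1, Submonoid.one_mem _, by simpa using h0⟩
    | mul x y hx hy ihx ihy =>
      intro h0
      have e : Submonoid.closure (⋃ S : {S : Submonoid R | IsLeftDen S ∧
          (S : Set R) ⊆ stronglyLocalizable R}, ((S : Submonoid R) : Set R)) = strongDen R := by
        rw [strongDen, sSup_eq_iSup', Submonoid.iSup_eq_closure]
      obtain ⟨t, ht, hq⟩ := ihy (r * x) (e ▸ hy) (by rw [mul_assoc, h0])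
      obtain ⟨t', ht', hq'⟩ := ihx (t * r) (e ▸ hx) (by rw [mul_assoc, hq])
      exact ⟨t' * t, Submonoid.mul_mem _ ht' ht, by rw [mul_assoc, hq']⟩

theorem isGreatest_strongDen [Nontrivial R] :
    IsGreatest {S : Submonoid R | IsLeftDen S ∧ (S : Set R) ⊆ stronglyLocalizable R}
      (strongDen R) :=
  ⟨⟨isLeftDen_strongDen, strongDen_subset⟩, fun _ hS => le_sSup hS⟩

variable (R) in
/-- The strong left localization radical `𝔩^s_R = ass(T_l(R))`. -/
def strongRadical [Nontrivial R] : Ideal R := ass (strongDen R) isLeftDen_strongDen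

instance [Nontrivial R] : (strongRadical R).IsTwoSided :=
  inferInstanceAs (ass (strongDen R) isLeftDen_strongDen).IsTwoSided

variable (R) in
/-- The largest strong left quotient ring `Q_l^s(R) = T_l(R)⁻¹R`. -/
abbrev StrongQuot [Nontrivial R] : Type u := LeftLocalization (strongDen R) isLeftDen_strongDen

variable (R) in
/-- The canonical homomorphism `R → Q_l^s(R)`. -/
noncomputable abbrev toStrongQuot [Nontrivial R] : R →+* StrongQuot R :=
  toLocalization (strongDen R) isLeftDen_strongDen

theorem isLeftDen_nonZeroDivisors (h : IsLeftOre (nonZeroDivisors R)) :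
    IsLeftDen (nonZeroDivisors R) :=
  ⟨h, fun r s hs h0 => ⟨s, hs, by rw [hs.2 r h0, mul_zero]⟩⟩

variable (R) in
/-- The classical left quotient ring `Q_{l,cl}(R) = C⁻¹R`, where `C` is the set of regular elements,
which exists if `C` is a left Ore set. -/
abbrev ClassicalQuot (h : IsLeftOre (nonZeroDivisors R)) : Type u :=
  LeftLocalization (nonZeroDivisors R) (isLeftDen_nonZeroDivisors h)

variable (R) in
/-- The canonical homomorphism `R → Q_{l,cl}(R)`. -/
noncomputable abbrev toClassicalQuot (h : IsLeftOre (nonZeroDivisors R)) :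
    R →+* ClassicalQuot R h :=
  toLocalization (nonZeroDivisors R) (isLeftDen_nonZeroDivisors h)

variable (R) in
/-- The product of all the maximal left localizations of `R`. -/
abbrev MaxLocProd : Type u := (S : maxDen R) → LeftLocalization S.1 S.2.prop

variable (R) in
/-- The diagonal homomorphism from `R` to the product of its maximal left localizations. -/
noncomputable abbrev toMaxLocProd : R →+* MaxLocProd R :=
  RingHom.pi fun S : maxDen R => toLocalization S.1 S.2.prop

/-- The rings `X` and `Y` are isomorphic over `R`, by a ring isomorphism that commutes with the
given homomorphisms from `R`. -/
def IsoOver {X Y : Type*} [Ring X] [Ring Y] (f : R →+* X) (g : R →+* Y) : Prop :=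
  ∃ φ : X ≃+* Y, ∀ r : R, φ (f r) = g r

/-- `1 = 1_1 + ⋯ + 1_s` is a sum of orthogonal idempotents of `R` that lift the identity elements
of the factors of a decomposition `R / rad R = B_1 × ⋯ × B_s` with simple Artinian rings `B_i`. -/
def LiftsSimpleFactors {s : ℕ} (f : Fin s → R) : Prop :=
  CompleteOrthogonalIdempotents f ∧
    ∃ (B : Fin s → Type u) (_ : ∀ i, Ring (B i)) (_ : ∀ i, IsSimpleRing (B i))
      (_ : ∀ i, IsArtinianRing (B i)) (φ : (R ⧸ Ring.jacobson R) ≃+* ((i : Fin s) → B i)),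
      ∀ i, φ (Ideal.Quotient.mk (Ring.jacobson R) (f i)) = Pi.single i 1

/-- The idempotent `e_I = ∑_{i ∈ I} 1_i`. -/
def idem {s : ℕ} (f : Fin s → R) (I : Finset (Fin s)) : R := ∑ i ∈ I, f i

/-- The sets `I` that index the poset `P = {e_I | I ≠ ∅, e_I R (1 - e_I) = 0}` of idempotents.
As all `1_i` are nonzero, `I ↦ e_I` is injective; `e_I ≤ e_J` means `I ⊆ J`. -/
def InI {s : ℕ} (f : Fin s → R) (I : Finset (Fin s)) : Prop :=
  I.Nonempty ∧ ∀ r : R, idem f I * r * (1 - idem f I) = 0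

open Classical in
/-- The sets `I` that index the minimal elements of `P`. -/
noncomputable def minI {s : ℕ} (f : Fin s → R) : Finset (Finset (Fin s)) :=
  {I | Minimal (InI f) I}

theorem minimal_of_mem_minI {s : ℕ} {f : Fin s → R} {I : Finset (Fin s)} (h : I ∈ minI f) :
    Minimal (InI f) I := by
  simpa [minI] using h

/-- The sum of the minimal elements of `P`. -/
noncomputable def minSum {s : ℕ} (f : Fin s → R) : R := ∑ I ∈ minI f, idem f I

theorem idem_mul_idem {s : ℕ} {f : Fin s → R} (hf : CompleteOrthogonalIdempotents f)
    (I J : Finset (Fin s)) : idem f I * idem f J = idem f (I ∩ J) := by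
  have h : ∀ i j, f i * f j = if i = j then f i else 0 := by
    intro i j
    split_ifs with hij
    · subst hij
      exact hf.idem i
    · exact hf.ortho hij
  simp only [idem, Finset.sum_mul_sum, h, Finset.sum_ite_eq]
  rw [← Finset.sum_filter, Finset.filter_mem_eq_inter]

theorem disjoint_minI {s : ℕ} {f : Fin s → R} (hf : CompleteOrthogonalIdempotents f)
    {I J : Finset (Fin s)} (hI : I ∈ minI f) (hJ : J ∈ minI f) (hne : I ≠ J) : I ∩ J = ∅ := by
  have hI := minimal_of_mem_minI hI
  have hJ := minimal_of_mem_minI hJ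
  by_contra h
  have hK : InI f (I ∩ J) := by
    refine ⟨Finset.nonempty_iff_ne_empty.2 h, fun r => ?_⟩
    have e1 : (1 : R) - idem f (I ∩ J) = (1 - idem f I) + idem f I * (1 - idem f J) := by
      rw [← idem_mul_idem hf, mul_sub, mul_one]; abel
    have h1 : idem f (I ∩ J) * r * (1 - idem f I) = 0 := by
      rw [Finset.inter_comm, ← idem_mul_idem hf, mul_assoc, mul_assoc,
        ← mul_assoc (idem f I), hI.prop.2 r, mul_zero]
    have h2 : idem f (I ∩ J) * r * (idem f I * (1 - idem f J)) = 0 := by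
      have := hJ.prop.2 (r * idem f I)
      rw [← idem_mul_idem hf]
      simp only [mul_assoc] at this ⊢
      rw [this, mul_zero]
    rw [e1, mul_add, h1, h2, add_zero]
  have hIJ := hI.le_of_le hK Finset.inter_subset_left
  have hJI := hJ.le_of_le hK Finset.inter_subset_right
  exact hne (le_antisymm (hIJ.trans Finset.inter_subset_right)
    (hJI.trans Finset.inter_subset_left))

theorem idem_mul_minSum {s : ℕ} {f : Fin s → R} (hf : CompleteOrthogonalIdempotents f)
    {I : Finset (Fin s)} (hI : I ∈ minI f) : idem f I * minSum f = idem f I := by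
  rw [minSum, Finset.mul_sum, Finset.sum_eq_single_of_mem I hI]
  · rw [idem_mul_idem hf, Finset.inter_self]
  · intro J hJ hne
    rw [idem_mul_idem hf, disjoint_minI hf hI hJ hne.symm]
    simp [idem]

theorem minSum_mul {s : ℕ} {f : Fin s → R} (hf : CompleteOrthogonalIdempotents f) (r : R) :
    minSum f * r * (1 - minSum f) = 0 := by
  conv_lhs => rw [minSum]
  rw [Finset.sum_mul, Finset.sum_mul]
  refine Finset.sum_eq_zero fun I hI => ?_
  have e1 : (1 : R) - minSum f = (1 - idem f I) * (1 - minSum f) := by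
    rw [sub_mul, mul_sub (idem f I), idem_mul_minSum hf hI]; simp
  have := (minimal_of_mem_minI hI).prop.2 r
  change idem f I * r * (1 - minSum f) = 0
  rw [e1, ← mul_assoc, this, zero_mul]

/-- The two-sided ideal `(1 - e)R`, for an element `e` with `eR(1 - e) = 0`. -/
def oneSubIdeal (e : R) (he : ∀ r : R, e * r * (1 - e) = 0) : Ideal R where
  carrier := {x | ∃ r : R, x = (1 - e) * r}
  zero_mem' := ⟨0, by simp⟩
  add_mem' := by
    rintro _ _ ⟨a, rfl⟩ ⟨b, rfl⟩
    exact ⟨a + b, by rw [mul_add]⟩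
  smul_mem' := by
    rintro c _ ⟨a, rfl⟩
    refine ⟨c * (1 - e) * a, ?_⟩
    have h : c * (1 - e) = (1 - e) * (c * (1 - e)) := by
      rw [sub_mul 1 e, one_mul, ← mul_assoc, he c, sub_zero]
    rw [smul_eq_mul, ← mul_assoc, ← mul_assoc, ← h]

instance (e : R) (he : ∀ r : R, e * r * (1 - e) = 0) : (oneSubIdeal e he).IsTwoSided :=
  ⟨by
    rintro _ b ⟨r, rfl⟩
    exact ⟨r * b, by rw [mul_assoc]⟩⟩

/-- The product of the rings `R/(1 - e')R`, where `e'` runs through the minimal elements of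
`P`. -/
abbrev MinProd {s : ℕ} (f : Fin s → R) : Type u :=
  (I : {I // I ∈ minI f}) → R ⧸ oneSubIdeal (idem f I.1) (minimal_of_mem_minI I.2).prop.2

/-- The diagonal homomorphism from `R` to the product of the rings `R/(1 - e')R`. -/
abbrev toMinProd {s : ℕ} (f : Fin s → R) : R →+* MinProd f :=
  RingHom.pi fun I : {I // I ∈ minI f} =>
    Ideal.Quotient.mk (oneSubIdeal (idem f I.1) (minimal_of_mem_minI I.2).prop.2)

end Basic

end StrongLoc

/-!
Let `R` be left Artinian and `S` a left denominator set of `R`. As the chain `Rs ⊇ Rs² ⊇ ⋯` becomes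
stationary, each `s ∈ S` is invertible modulo `ass(S)` (`le_unitsMod_ass`), so `R → S⁻¹R` is
surjective with kernel `ass(S)`. Fix lifts `1_i` of the identities of the simple factors, and let
`I` be the set of those `i` with `1_i ∉ ass(S)`. Every `x ∈ ass(S)` satisfies `e_I x ∈ rad(R) x`, so
that `e_I x = 0`, and therefore `ass(S) = (1 - e_I)R` with `e_I R (1 - e_I) = 0` (`exists_ass_eq`).
Conversely, if `I` is nonempty with `e_I R (1 - e_I) = 0`, then the units modulo `(1 - e_I)R` form a
left denominator set with this associated ideal (`isLeftDen_unitsMod`). These sets grow as `I`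
shrinks, so the maximal left denominator sets correspond to the minimal elements `e'` of
`P = {e_I | I ≠ ∅, e_I R (1 - e_I) = 0}` (`mem_maxDen_iff`).

The minimal elements are pairwise orthogonal with sum `e`, so the Chinese remainder theorem
(`exists_idem_mul_sub_eq_zero`) identifies the intersection of the maximal left denominator sets
with the units modulo `(1 - e)R`, which is a left denominator set itself and hence equals `T_l(R)`
(`strongDen_eq`). All the rings in question that receive a homomorphism from `R` are thus images
of `R` under surjections with kernel `(1 - e)R`, and `isoOver_of_surjective` applies.

Now let `R` be the classical left quotient ring of `A`. Contraction `S ↦ A ∩ S` preserves left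
denominator sets that contain the units of `R`, and `(A ∩ S)⁻¹A ≅ S⁻¹R` (`isoOver_comap`).
A left denominator set of `A` generates, together with the units of `R`, a left denominator set of
`R` (`exists_le_comap`). Consequently contraction is a bijection from the maximal left denominator
sets of `R` to those of `A` (`maxDenEquiv`), and it takes `T_l(R)` to `T_l(A)`
(`strongDen_eq_comap`).
-/

namespace StrongLoc

/-! ### Localization at a left denominator set -/

section Localization

variable {R : Type u} [Ring R] {S : Submonoid R} (h : IsLeftDen S)

theorem isUnit_toLocalization {s : R} (hs : s ∈ S) : IsUnit (toLocalization S h s) := by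
  let _ := h.oreSet
  exact OreLocalization.numerator_isUnit (⟨s, hs⟩ : S)

theorem toLocalization_eq_zero_iff {r : R} : toLocalization S h r = 0 ↔ r ∈ ass S h := by
  let _ := h.oreSet
  change ((r /ₒ (1 : S) : OreLocalization S R) = 0) ↔ _
  constructor
  · intro h0
    rw [OreLocalization.zero_def, OreLocalization.oreDiv_eq_iff] at h0
    obtain ⟨u, v, h1, h2⟩ := h0
    simp only [OneMemClass.coe_one, mul_one] at h2
    refine ⟨u, u.2, ?_⟩
    rw [h2]
    simpa [Submonoid.smul_def] using h1.symm
  · rintro ⟨s, hs, h0⟩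
    rw [OreLocalization.zero_def, OreLocalization.oreDiv_eq_iff]
    exact ⟨⟨s, hs⟩, s, by simp [h0], by simp⟩

theorem exists_toLocalization_mul_eq (y : LeftLocalization S h) :
    ∃ s ∈ S, ∃ b, toLocalization S h s * y = toLocalization S h b := by
  let _ := h.oreSet
  change OreLocalization S R at y
  induction y using OreLocalization.ind with
  | _ r s =>
    refine ⟨s, s.2, r, ?_⟩
    change ((s : R) /ₒ (1 : S)) * (r /ₒ s) = (r /ₒ (1 : S) : OreLocalization S R)
    exact OreLocalization.mul_cancel

end Localization

section IsoOver

variable {R : Type*} [Ring R] {X Y : Type*} [Ring X] [Ring Y]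
  {f : R →+* X} {g : R →+* Y}

theorem IsoOver.symm (h : IsoOver f g) : IsoOver g f := by
  obtain ⟨φ, hφ⟩ := h
  exact ⟨φ.symm, fun r => by rw [← hφ, φ.symm_apply_apply]⟩

/-- Two surjective homomorphisms with the same kernel have isomorphic targets. -/
theorem isoOver_of_surjective (hf : Function.Surjective f) (hg : Function.Surjective g)
    (h : ∀ r, f r = 0 ↔ g r = 0) : IsoOver f g := by
  have hfg : ∀ a b, f a = f b ↔ g a = g b := fun a b => by
    rw [← sub_eq_zero, ← map_sub, h, map_sub, sub_eq_zero]
  choose p hp using hf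
  have hgp : ∀ r, g (p (f r)) = g r := fun r => (hfg _ _).1 (hp _)
  let φ : X →+* Y :=
    { toFun x := g (p x)
      map_one' := by simpa using hgp 1
      map_zero' := by simpa using hgp 0
      map_mul' a b := by rw [← map_mul, ← hfg, map_mul, hp, hp, hp]
      map_add' a b := by rw [← map_add, ← hfg, map_add, hp, hp, hp] }
  refine ⟨RingEquiv.ofBijective φ ⟨fun a b hab => ?_, fun y => ?_⟩, hgp⟩
  · rw [← hp a, ← hp b]
    exact (hfg _ _).2 hab
  · obtain ⟨r, rfl⟩ := hg y
    exact ⟨f r, hgp r⟩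

end IsoOver

/-- The characterization of `S⁻¹R` up to isomorphism over `R`: elements of `S` become invertible,
the kernel is `ass(S)`, and every element is a left fraction. -/
theorem isoOver_toLocalization {R : Type u} [Ring R] {S : Submonoid R} (h : IsLeftDen S)
    {Y : Type*} [Ring Y] {g : R →+* Y} (hunit : ∀ s ∈ S, IsUnit (g s))
    (hker : ∀ r, g r = 0 ↔ r ∈ ass S h) (hfrac : ∀ y, ∃ s ∈ S, ∃ b, g s * y = g b) :
    IsoOver (toLocalization S h) g := by
  let _ := h.oreSet
  let fS : S →* Yˣ := IsUnit.liftRight (g.toMonoidHom.comp S.subtype) fun s => hunit s s.2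
  have hfS : ∀ s : S, g s = fS s := fun s => rfl
  let φ : OreLocalization S R →+* Y := OreLocalization.universalHom g fS hfS
  have hφ : ∀ r, φ (toLocalization S h r) = g r := fun r =>
    OreLocalization.universalHom_commutes g fS hfS
  have hinj : Function.Injective φ := by
    refine (injective_iff_map_eq_zero φ).2 fun y hy => ?_
    obtain ⟨s, hs, b, hb⟩ := exists_toLocalization_mul_eq h y
    have hb0 : g b = 0 := by
      rw [← hφ, ← hb]
      exact (map_mul φ _ _).trans (by rw [hy, mul_zero])
    rw [(toLocalization_eq_zero_iff h).2 ((hker b).1 hb0)] at hb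
    exact (isUnit_toLocalization h hs).mul_right_eq_zero.1 hb
  have hsurj : Function.Surjective φ := fun y => by
    obtain ⟨s, hs, b, hb⟩ := hfrac y
    obtain ⟨u, hu⟩ := isUnit_toLocalization h hs
    refine ⟨(↑u⁻¹ * toLocalization S h b : LeftLocalization S h), (hunit s hs).mul_left_cancel ?_⟩
    rw [hb, ← hφ s, ← hφ b, ← hu]
    exact (map_mul φ _ _).symm.trans (congrArg φ (u.mul_inv_cancel_left _))
  exact ⟨RingEquiv.ofBijective φ ⟨hinj, hsurj⟩, hφ⟩

/-! ### Units modulo an ideal -/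

section UnitsMod

variable {R : Type u} [Ring R]

theorem mem_oneSubIdeal {e : R} {he : ∀ r : R, e * r * (1 - e) = 0} (hi : e * e = e) {x : R} :
    x ∈ oneSubIdeal e he ↔ e * x = 0 := by
  constructor
  · rintro ⟨r, rfl⟩
    rw [← mul_assoc, mul_sub, mul_one, hi, sub_self, zero_mul]
  · intro h
    exact ⟨x, by rw [sub_mul, h, one_mul, sub_zero]⟩

/-- The elements of `R` that are invertible modulo a two-sided ideal. -/
def unitsMod (a : Ideal R) [a.IsTwoSided] : Submonoid R :=
  (IsUnit.submonoid (R ⧸ a)).comap (Ideal.Quotient.mk a)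

theorem mem_unitsMod {a : Ideal R} [a.IsTwoSided] {s : R} :
    s ∈ unitsMod a ↔ ∃ v, v * s - 1 ∈ a ∧ s * v - 1 ∈ a := by
  have key : ∀ x y : R, x * y - 1 ∈ a ↔ Ideal.Quotient.mk a x * Ideal.Quotient.mk a y = 1 := by
    intro x y
    rw [← Ideal.Quotient.eq_zero_iff_mem, map_sub, map_mul, map_one, sub_eq_zero]
  change IsUnit (Ideal.Quotient.mk a s) ↔ _
  simp only [key]
  constructor
  · rintro ⟨u, hu⟩
    obtain ⟨v, hv⟩ := Ideal.Quotient.mk_surjective (↑u⁻¹ : R ⧸ a)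
    exact ⟨v, by rw [hv, ← hu, u.inv_mul], by rw [hv, ← hu, u.mul_inv]⟩
  · rintro ⟨v, h1, h2⟩
    exact ⟨⟨_, _, h2, h1⟩, rfl⟩

theorem unitsMod_mono {a b : Ideal R} [a.IsTwoSided] [b.IsTwoSided] (h : a ≤ b) :
    unitsMod a ≤ unitsMod b := fun s hs => by
  obtain ⟨v, h1, h2⟩ := mem_unitsMod.1 hs
  exact mem_unitsMod.2 ⟨v, h h1, h h2⟩

theorem mem_unitsMod_of_isUnit {a : Ideal R} [a.IsTwoSided] {u : R} (hu : IsUnit u) :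
    u ∈ unitsMod a :=
  hu.map (Ideal.Quotient.mk a)

variable {e : R} (he : ∀ r : R, e * r * (1 - e) = 0)

/-- If `e ≠ 0` is idempotent and `eR(1 - e) = 0`, then the units modulo `(1 - e)R` form a left
denominator set: `e` is one of them, and it annihilates `(1 - e)R` from the left. -/
theorem isLeftDen_unitsMod (hi : e * e = e) (h0 : e ≠ 0) :
    IsLeftDen (unitsMod (oneSubIdeal e he)) := by
  have hmem : e ∈ unitsMod (oneSubIdeal e he) :=
    mem_unitsMod.2 ⟨1, by rw [mem_oneSubIdeal hi]; simp [mul_sub, hi],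
      by rw [mem_oneSubIdeal hi]; simp [mul_sub, hi]⟩
  refine ⟨⟨fun h => ?_, fun r s hs => ?_⟩, fun r s hs hrs => ?_⟩
  · obtain ⟨v, hv, -⟩ := mem_unitsMod.1 h
    rw [mem_oneSubIdeal hi] at hv
    simp [h0] at hv
  · obtain ⟨v, hv, -⟩ := mem_unitsMod.1 hs
    refine ⟨e, hmem, e * r * v, ?_⟩
    have := (mem_oneSubIdeal hi).1 ((oneSubIdeal e he).mul_mem_left r hv)
    rw [mul_sub, mul_sub, sub_eq_zero] at this
    simpa [mul_assoc] using this.symm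
  · obtain ⟨v, -, hv⟩ := mem_unitsMod.1 hs
    refine ⟨e, hmem, ?_⟩
    have := (mem_oneSubIdeal hi).1 ((oneSubIdeal e he).mul_mem_left r hv)
    rw [mul_sub, ← mul_assoc, hrs, zero_mul, zero_sub, mul_one, mul_neg, neg_eq_zero] at this
    exact this

theorem mem_ass_unitsMod (hi : e * e = e) (h : IsLeftDen (unitsMod (oneSubIdeal e he))) {x : R} :
    x ∈ ass _ h ↔ e * x = 0 := by
  constructor
  · rintro ⟨s, hs, h0⟩
    obtain ⟨v, hv, -⟩ := mem_unitsMod.1 hs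
    have := (mem_oneSubIdeal hi).1 ((oneSubIdeal e he).mul_mem_right x hv)
    rw [sub_mul, mul_assoc, h0, mul_zero, zero_sub, one_mul, mul_neg, neg_eq_zero] at this
    exact this
  · intro hx
    refine ⟨e, mem_unitsMod.2 ⟨1, ?_, ?_⟩, hx⟩ <;> rw [mem_oneSubIdeal hi] <;> simp [mul_sub, hi]

end UnitsMod

/-! ### Left denominator sets of left Artinian rings -/

section Artinian

variable {R : Type u} [Ring R] [IsArtinianRing R]

/-- In a left Artinian ring, the elements of a left denominator set `S` are already invertible
modulo `ass(S)`. -/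
theorem le_unitsMod_ass {S : Submonoid R} (h : IsLeftDen S) : S ≤ unitsMod (ass S h) := by
  intro s hs
  have hcancel : ∀ x, ∀ t ∈ S, x * t ∈ ass S h → x ∈ ass S h := by
    rintro x t ht ⟨t', ht', h0⟩
    obtain ⟨w, hw, h1⟩ := h.2 (t' * x) t ht (by rw [mul_assoc, h0])
    exact ⟨w * t', S.mul_mem hw ht', by rw [mul_assoc, h1]⟩
  -- The chain `Rs ⊇ Rs² ⊇ ⋯` becomes stationary.
  obtain ⟨n, hn⟩ := IsArtinian.monotone_stabilizes (R := R) (M := R)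
    ⟨fun n => OrderDual.toDual (Ideal.span {s ^ n}), monotone_nat_of_le_succ fun n => by
      change Ideal.span {s ^ (n + 1)} ≤ Ideal.span {s ^ n}
      rw [Ideal.span_singleton_le_iff_mem, Ideal.mem_span_singleton', pow_succ']
      exact ⟨s, rfl⟩⟩
  have hn1 : Ideal.span {s ^ n} = Ideal.span {s ^ (n + 1)} := hn (n + 1) n.le_succ
  obtain ⟨v, hv⟩ := Ideal.mem_span_singleton'.1 (hn1 ▸ Ideal.mem_span_singleton_self (s ^ n))
  have hvs : v * s - 1 ∈ ass S h := by
    refine hcancel _ (s ^ n) (S.pow_mem hs n) ?_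
    rw [sub_mul, mul_assoc, ← pow_succ', hv, one_mul, sub_self]
    exact zero_mem _
  refine mem_unitsMod.2 ⟨v, hvs, hcancel _ s hs ?_⟩
  have : (s * v - 1) * s = s * (v * s - 1) := by noncomm_ring
  rw [this]
  exact (ass S h).mul_mem_left s hvs

theorem toLocalization_surjective {S : Submonoid R} (h : IsLeftDen S) :
    Function.Surjective (toLocalization S h) := fun y => by
  obtain ⟨s, hs, b, hb⟩ := exists_toLocalization_mul_eq h y
  obtain ⟨v, hv, -⟩ := mem_unitsMod.1 (le_unitsMod_ass h hs)
  rw [← toLocalization_eq_zero_iff, map_sub, map_mul, map_one, sub_eq_zero] at hv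
  exact ⟨v * b, by rw [map_mul, ← hb, ← mul_assoc, hv, one_mul]⟩

theorem isNilpotent_of_mem_jacobson {x : R} (hx : x ∈ Ring.jacobson R) : IsNilpotent x := by
  obtain ⟨n, hn⟩ := IsSemiprimaryRing.isNilpotent (R := R)
  exact ⟨n, by simpa [hn] using Ideal.pow_mem_pow hx n⟩

/-- A decomposition `1 = 1_1 + ⋯ + 1_s` exists, by the Wedderburn–Artin theorem for `R / rad(R)` and
the lifting of orthogonal idempotents modulo the nilpotent ideal `rad(R)`. -/
theorem exists_liftsSimpleFactors : ∃ (s : ℕ) (f : Fin s → R), LiftsSimpleFactors f := by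
  have hker : ∀ x ∈ RingHom.ker (Ideal.Quotient.mk (Ring.jacobson R)), IsNilpotent x := by
    intro x hx
    rw [Ideal.mk_ker] at hx
    exact isNilpotent_of_mem_jacobson hx
  obtain ⟨s, D, d, _, hd, ⟨φ⟩⟩ :=
    IsSemisimpleRing.exists_ringEquiv_pi_matrix_divisionRing (R ⧸ Ring.jacobson R)
  obtain ⟨f, hf, hfe⟩ := CompleteOrthogonalIdempotents.lift_of_isNilpotent_ker
    (Ideal.Quotient.mk (Ring.jacobson R)) hker
    ((CompleteOrthogonalIdempotents.single fun i => Matrix (Fin (d i)) (Fin (d i)) (D i)).map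
      φ.symm.toRingHom) fun _ => Ideal.Quotient.mk_surjective _
  refine ⟨s, f, hf, fun i => Matrix (Fin (d i)) (Fin (d i)) (D i), fun i => inferInstance,
    fun i => inferInstance, fun i => inferInstance, φ, fun i => ?_⟩
  have := congrFun hfe i
  simp only [Function.comp_apply] at this
  rw [this]
  simp

end Artinian

section Idempotents

variable {R : Type u} [Ring R] {s : ℕ} {f : Fin s → R}

theorem idem_mul_self (hf : CompleteOrthogonalIdempotents f) (I : Finset (Fin s)) :
    idem f I * idem f I = idem f I := by
  rw [idem_mul_idem hf, Finset.inter_self]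

theorem idem_mul_apply (hf : CompleteOrthogonalIdempotents f) (I : Finset (Fin s)) (i : Fin s) :
    idem f I * f i = if i ∈ I then f i else 0 := by
  have h := idem_mul_idem hf I {i}
  rw [show idem f {i} = f i by simp [idem]] at h
  rw [h]
  split_ifs with hi
  · rw [Finset.inter_singleton_of_mem hi]; simp [idem]
  · rw [Finset.inter_singleton_of_notMem hi]; simp [idem]

theorem LiftsSimpleFactors.ne_zero (hf : LiftsSimpleFactors f) (i : Fin s) : f i ≠ 0 := by
  obtain ⟨-, B, _, _, _, φ, hφ⟩ := hf
  intro h0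
  have h1 := congrFun (hφ i) i
  simp [h0] at h1

theorem LiftsSimpleFactors.idem_ne_zero (hf : LiftsSimpleFactors f) {I : Finset (Fin s)}
    (hI : I.Nonempty) : idem f I ≠ 0 := by
  obtain ⟨i, hi⟩ := hI
  intro h0
  have := idem_mul_apply hf.1 I i
  rw [h0, zero_mul, if_pos hi] at this
  exact hf.ne_zero i this.symm

theorem LiftsSimpleFactors.subset_of_idem_mul (hf : LiftsSimpleFactors f) {I J : Finset (Fin s)}
    (h : ∀ x, idem f I * x = 0 → idem f J * x = 0) : J ⊆ I := by
  intro j hj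
  by_contra hjI
  have := h (f j) (by rw [idem_mul_apply hf.1, if_neg hjI])
  rw [idem_mul_apply hf.1, if_pos hj] at this
  exact hf.ne_zero j this

theorem LiftsSimpleFactors.minI_nonempty [Nontrivial R] (hf : LiftsSimpleFactors f) :
    (minI f).Nonempty := by
  have huniv : idem f Finset.univ = 1 := hf.1.complete
  have h : InI f Finset.univ := by
    refine ⟨?_, fun r => by rw [huniv]; simp⟩
    rw [Finset.nonempty_iff_ne_empty]
    intro h0
    rw [h0] at huniv
    simp [idem] at huniv
  obtain ⟨J, -, hJ⟩ := exists_minimal_le_of_wellFoundedLT (InI f) _ h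
  exact ⟨J, by simpa [minI] using hJ⟩

theorem minSum_mul_eq_zero_iff (hf : CompleteOrthogonalIdempotents f) {x : R} :
    minSum f * x = 0 ↔ ∀ I ∈ minI f, idem f I * x = 0 := by
  constructor
  · intro h I hI
    rw [← idem_mul_minSum hf hI, mul_assoc, h, mul_zero]
  · intro h
    rw [minSum, Finset.sum_mul]
    exact Finset.sum_eq_zero h

theorem minSum_mul_self (hf : CompleteOrthogonalIdempotents f) :
    minSum f * minSum f = minSum f := by
  conv_lhs => enter [1]; rw [minSum]
  rw [Finset.sum_mul]
  exact Finset.sum_congr rfl fun I hI => idem_mul_minSum hf hI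

theorem LiftsSimpleFactors.minSum_ne_zero [Nontrivial R] (hf : LiftsSimpleFactors f) :
    minSum f ≠ 0 := by
  obtain ⟨I, hI⟩ := hf.minI_nonempty
  intro h0
  have := idem_mul_minSum hf.1 hI
  rw [h0, mul_zero] at this
  exact hf.idem_ne_zero (minimal_of_mem_minI hI).prop.1 this.symm

/-- The Chinese remainder theorem for the ideals `(1 - e')R`, where `e'` runs through the minimal
elements of `P`. -/
theorem exists_idem_mul_sub_eq_zero (hf : CompleteOrthogonalIdempotents f)
    (x : Finset (Fin s) → R) : ∃ y, ∀ I ∈ minI f, idem f I * (y - x I) = 0 := by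
  refine ⟨∑ J ∈ minI f, idem f J * x J, fun I hI => ?_⟩
  rw [mul_sub, Finset.mul_sum, Finset.sum_eq_single_of_mem I hI, ← mul_assoc, idem_mul_self hf,
    sub_self]
  intro J hJ hne
  rw [← mul_assoc, idem_mul_idem hf, disjoint_minI hf hI hJ hne.symm]
  simp [idem]

theorem toMinProd_surjective (hf : CompleteOrthogonalIdempotents f) :
    Function.Surjective (toMinProd f) := by
  intro y
  choose x hx using fun I => Ideal.Quotient.mk_surjective (y I)
  classical
  obtain ⟨r, hr⟩ := exists_idem_mul_sub_eq_zero hf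
    fun I => if hI : I ∈ minI f then x ⟨I, hI⟩ else 0
  refine ⟨r, funext fun ⟨I, hI⟩ => ?_⟩
  rw [← hx]
  refine Ideal.Quotient.eq.2 ((mem_oneSubIdeal (idem_mul_self hf I)).2 ?_)
  simpa [hI] using hr I hI

theorem toMinProd_eq_zero_iff (hf : CompleteOrthogonalIdempotents f) {x : R} :
    toMinProd f x = 0 ↔ minSum f * x = 0 := by
  rw [minSum_mul_eq_zero_iff hf, funext_iff, Subtype.forall]
  refine forall₂_congr fun I hI => ?_
  exact Ideal.Quotient.eq_zero_iff_mem.trans (mem_oneSubIdeal (idem_mul_self hf I))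

end Idempotents

section Classification

variable {R : Type u} [Ring R] [IsArtinianRing R] {s : ℕ} {f : Fin s → R}

open Classical in
/-- For every left denominator set `S` of a left Artinian ring, `ass(S) = (1 - e_I)R`, where `I` is
the set of those `i` for which `1_i ∉ ass(S)`. Indeed, the image of `ass(S)` in the simple factor
with index `i ∈ I` is zero, so that elements of `S` are invertible there. Hence `e_I x ∈ rad(R) x`
for all `x ∈ ass(S)`, and `e_I x = 0` as `rad(R)` is nilpotent. -/
theorem exists_ass_eq (hf : LiftsSimpleFactors f) {S : Submonoid R} (h : IsLeftDen S) :
    ∃ I, InI f I ∧ ∀ x, x ∈ ass S h ↔ idem f I * x = 0 := by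
  obtain ⟨hc, B, _, _, _, φ, hφ⟩ := hf
  set J := Ring.jacobson R
  let π : R →+* ((i : Fin s) → B i) := φ.toRingHom.comp (Ideal.Quotient.mk J)
  have hπ0 : ∀ x, π x = 0 ↔ x ∈ J := fun x => by
    rw [← Ideal.Quotient.eq_zero_iff_mem]
    exact φ.map_eq_zero_iff
  have hπf : ∀ i, π (f i) = Pi.single i 1 := hφ
  have hπ : Function.Surjective π := φ.surjective.comp Ideal.Quotient.mk_surjective
  set a := ass S h
  have hone : (1 : R) ∉ a := by
    rintro ⟨t, ht, h0⟩
    rw [mul_one] at h0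
    exact h.1.1 (h0 ▸ ht)
  -- An idempotent `1_i` outside of `ass(S)` belongs to a factor in which `ass(S)` vanishes.
  have hvanish : ∀ i, f i ∉ a → ∀ α ∈ a, π α i = 0 := by
    intro i hi
    by_contra! hne
    obtain ⟨α, hα, hα0⟩ := hne
    let T : TwoSidedIdeal (B i) := .mk' {b | ∃ α ∈ a, π α i = b} ⟨0, zero_mem _, by simp⟩
      (by rintro _ _ ⟨x, hx, rfl⟩ ⟨y, hy, rfl⟩; exact ⟨x + y, add_mem hx hy, by simp⟩)
      (by rintro _ ⟨x, hx, rfl⟩; exact ⟨-x, neg_mem hx, by simp⟩)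
      (by
        rintro b _ ⟨x, hx, rfl⟩
        obtain ⟨r, hr⟩ := hπ (Pi.single i b)
        exact ⟨r * x, a.mul_mem_left r hx, by simp [hr]⟩)
      (by
        rintro _ b ⟨x, hx, rfl⟩
        obtain ⟨r, hr⟩ := hπ (Pi.single i b)
        exact ⟨x * r, a.mul_mem_right r hx, by simp [hr]⟩)
    have hT : ∀ b, b ∈ T ↔ ∃ α ∈ a, π α i = b := fun b => TwoSidedIdeal.mem_mk' ..
    have hT1 : (1 : B i) ∈ T := by
      rcases eq_bot_or_eq_top T with h0 | h0
      · have := (hT _).2 ⟨α, hα, rfl⟩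
        rw [h0, TwoSidedIdeal.mem_bot] at this
        exact absurd this hα0
      · rw [h0]; trivial
    obtain ⟨β, hβ, hβ1⟩ := (hT 1).1 hT1
    have hρ : f i * β - f i ∈ J := by
      rw [← hπ0, map_sub, map_mul, hπf]
      ext j
      by_cases hj : j = i
      · subst hj; simp [hβ1]
      · simp [hj]
    -- Modulo `ass(S)`, the idempotent `1_i` is congruent to an element of `-rad(R)`, hence zero.
    obtain ⟨w, hw⟩ := (isNilpotent_of_mem_jacobson hρ).isUnit_one_add.exists_right_inv
    have hmem : f i * β * w ∈ a := a.mul_mem_right w (a.mul_mem_left (f i) hβ)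
    have h1 : f i * β = f i * (1 + (f i * β - f i)) := by
      rw [mul_add, mul_one, mul_sub, ← mul_assoc, (hc.idem i).eq]; abel
    rw [h1, mul_assoc, hw, mul_one] at hmem
    exact hi hmem
  let I : Finset (Fin s) := {i | f i ∉ a}
  have hsub : 1 - idem f I ∈ a := by
    have : (1 : R) = idem f I + ∑ i ∈ Finset.univ.filter (¬ f · ∉ a), f i := by
      rw [idem, Finset.sum_filter_add_sum_filter_not, hc.complete]
    rw [sub_eq_iff_eq_add'.2 this]
    exact sum_mem fun i hi => by simpa using hi
  have hstep : ∀ x ∈ a, ∃ ρ ∈ J, idem f I * x = ρ * x := by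
    rintro x ⟨t, ht, htx⟩
    obtain ⟨v, hv, -⟩ := mem_unitsMod.1 (le_unitsMod_ass h ht)
    refine ⟨idem f I - idem f I * (v * t), ?_, by simp [sub_mul, mul_assoc, htx]⟩
    rw [← hπ0, idem, Finset.sum_mul, ← Finset.sum_sub_distrib, map_sum]
    refine Finset.sum_eq_zero fun i hi => ?_
    have := hvanish i (by simpa [I] using hi) _ hv
    rw [map_sub, map_mul, hπf]
    ext j
    by_cases hj : j = i
    · subst hj
      rw [map_sub, map_mul, map_one] at this
      simpa [sub_eq_zero, eq_comm (a := (1 : B j))] using this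
    · simp [hj]
  have hpow : ∀ n : ℕ, ∀ x ∈ a, ∃ ρ ∈ J ^ n, idem f I * x = ρ * x := by
    intro n
    induction n with
    | zero => exact fun x hx => ⟨idem f I, by rw [Submodule.pow_zero, Ideal.one_eq_top]; trivial, rfl⟩
    | succ n ih =>
      intro x hx
      obtain ⟨ρ, hρ, h1⟩ := hstep x hx
      obtain ⟨ρ', hρ', h2⟩ := ih (ρ * x) (a.mul_mem_left ρ hx)
      refine ⟨ρ' * ρ, Ideal.mul_mem_mul hρ' hρ, ?_⟩
      rw [mul_assoc, ← h2, ← h1, ← mul_assoc, idem_mul_self hc]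
  have hkill : ∀ x ∈ a, idem f I * x = 0 := by
    intro x hx
    obtain ⟨n, hn⟩ := IsSemiprimaryRing.isNilpotent (R := R)
    obtain ⟨ρ, hρ, h1⟩ := hpow n x hx
    rw [hn] at hρ
    rw [h1, show ρ = 0 by simpa using hρ, zero_mul]
  refine ⟨I, ⟨?_, fun r => ?_⟩, fun x => ⟨hkill x, fun hx => ?_⟩⟩
  · rw [Finset.nonempty_iff_ne_empty]
    intro h0
    rw [h0] at hsub
    exact hone (by simpa [idem] using hsub)
  · rw [mul_assoc]
    exact hkill _ (a.mul_mem_left r hsub)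
  · have := a.mul_mem_right x hsub
    rwa [sub_mul, hx, one_mul, sub_zero] at this

omit [IsArtinianRing R] in
theorem isLeftDen_idemUnits (hf : LiftsSimpleFactors f) {I : Finset (Fin s)} (hI : InI f I) :
    IsLeftDen (unitsMod (oneSubIdeal (idem f I) hI.2)) :=
  isLeftDen_unitsMod hI.2 (idem_mul_self hf.1 I) (hf.idem_ne_zero hI.1)

omit [IsArtinianRing R] in
theorem oneSubIdeal_idem_le (hf : CompleteOrthogonalIdempotents f) {I J : Finset (Fin s)}
    (hI : InI f I) (hJ : InI f J) (h : I ⊆ J) :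
    oneSubIdeal (idem f J) hJ.2 ≤ oneSubIdeal (idem f I) hI.2 := fun x hx => by
  rw [mem_oneSubIdeal (idem_mul_self hf _)] at hx ⊢
  rw [← Finset.inter_eq_left.2 h, ← idem_mul_idem hf, mul_assoc, hx, mul_zero]

/-- Every left denominator set of a left Artinian ring consists of units modulo `(1 - e')R`, for
some minimal element `e'` of `P`. -/
theorem exists_minI_le (hf : LiftsSimpleFactors f) {S : Submonoid R} (h : IsLeftDen S) :
    ∃ (I : Finset (Fin s)) (hI : I ∈ minI f),
      S ≤ unitsMod (oneSubIdeal (idem f I) (minimal_of_mem_minI hI).prop.2) := by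
  obtain ⟨J, hJ, hass⟩ := exists_ass_eq hf h
  obtain ⟨I, hIJ, hI⟩ := exists_minimal_le_of_wellFoundedLT (InI f) J hJ
  refine ⟨I, by simpa [minI] using hI, (le_unitsMod_ass h).trans (unitsMod_mono ?_)⟩
  refine le_trans (fun x hx => ?_) (oneSubIdeal_idem_le hf.1 hI.prop hJ hIJ)
  rwa [mem_oneSubIdeal (idem_mul_self hf.1 _), ← hass]

/-- The maximal left denominator sets of a left Artinian ring are the sets of units modulo the
ideals `(1 - e')R`, where `e'` runs through the minimal elements of `P`. -/
theorem mem_maxDen_iff (hf : LiftsSimpleFactors f) {S : Submonoid R} :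
    S ∈ maxDen R ↔ ∃ (I : Finset (Fin s)) (hI : I ∈ minI f),
      S = unitsMod (oneSubIdeal (idem f I) (minimal_of_mem_minI hI).prop.2) := by
  constructor
  · intro hS
    obtain ⟨I, hI, hle⟩ := exists_minI_le hf hS.prop
    exact ⟨I, hI, hS.eq_of_le (isLeftDen_idemUnits hf (minimal_of_mem_minI hI).prop) hle⟩
  · rintro ⟨I, hI, rfl⟩
    have hden := isLeftDen_idemUnits hf (minimal_of_mem_minI hI).prop
    refine ⟨hden, fun T hT hle => ?_⟩
    obtain ⟨J, hJ, hTJ⟩ := exists_minI_le hf hT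
    have hden' := isLeftDen_idemUnits hf (minimal_of_mem_minI hJ).prop
    have hJI : J ⊆ I := hf.subset_of_idem_mul fun x hx => by
      rw [← mem_ass_unitsMod _ (idem_mul_self hf.1 _) hden] at hx
      rw [← mem_ass_unitsMod _ (idem_mul_self hf.1 _) hden']
      obtain ⟨t, ht, h0⟩ := hx
      exact ⟨t, hTJ (hle ht), h0⟩
    obtain rfl : J = I := hJI.antisymm
      ((minimal_of_mem_minI hI).le_of_le (minimal_of_mem_minI hJ).prop hJI)
    exact hTJ

theorem mem_ass_maxDen_iff (hf : LiftsSimpleFactors f) {x : R} :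
    (∀ S : maxDen R, x ∈ ass S.1 S.2.prop) ↔ minSum f * x = 0 := by
  rw [minSum_mul_eq_zero_iff hf.1]
  constructor
  · intro h I hI
    have := h ⟨_, (mem_maxDen_iff hf).2 ⟨I, hI, rfl⟩⟩
    rwa [mem_ass_unitsMod _ (idem_mul_self hf.1 _)] at this
  · rintro h ⟨S, hS⟩
    obtain ⟨I, hI, rfl⟩ := (mem_maxDen_iff hf).1 hS
    exact (mem_ass_unitsMod _ (idem_mul_self hf.1 _) _).2 (h I hI)

/-- The strongly left localizable elements of a left Artinian ring are the units modulo
`(1 - e)R`. -/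
theorem stronglyLocalizable_eq (hf : LiftsSimpleFactors f) :
    stronglyLocalizable R = unitsMod (oneSubIdeal (minSum f) (minSum_mul hf.1)) := by
  have hi := fun I => idem_mul_self hf.1 I
  ext u
  constructor
  · intro hu
    have hinv : ∀ I, ∃ v, I ∈ minI f → idem f I * (v * u - 1) = 0 ∧ idem f I * (u * v - 1) = 0 := by
      intro I
      by_cases hI : I ∈ minI f
      · obtain ⟨v, h1, h2⟩ := mem_unitsMod.1
          (Set.mem_iInter₂.1 hu _ ((mem_maxDen_iff hf).2 ⟨I, hI, rfl⟩))
        rw [mem_oneSubIdeal (hi I)] at h1 h2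
        exact ⟨v, fun _ => ⟨h1, h2⟩⟩
      · exact ⟨0, fun h => absurd h hI⟩
    choose v hv using hinv
    obtain ⟨y, hy⟩ := exists_idem_mul_sub_eq_zero hf.1 v
    refine mem_unitsMod.2 ⟨y, ?_, ?_⟩ <;>
      rw [mem_oneSubIdeal (minSum_mul_self hf.1), minSum_mul_eq_zero_iff hf.1] <;> intro I hI
    · have h1 : y * u - 1 = (y - v I) * u + (v I * u - 1) := by noncomm_ring
      rw [h1, mul_add, ← mul_assoc, hy I hI, (hv I hI).1, zero_mul, add_zero]
    · have h1 : u * y - 1 = u * (y - v I) + (u * v I - 1) := by noncomm_ring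
      -- The ideal `(1 - e')R` is also a left ideal.
      have h2 : idem f I * (u * (y - v I)) = 0 := by
        rw [← mem_oneSubIdeal (he := (minimal_of_mem_minI hI).prop.2) (hi I)]
        exact Ideal.mul_mem_left _ u ((mem_oneSubIdeal (hi I)).2 (hy I hI))
      rw [h1, mul_add, h2, (hv I hI).2, add_zero]
  · intro hu
    refine Set.mem_iInter₂.2 fun S hS => ?_
    obtain ⟨I, hI, rfl⟩ := (mem_maxDen_iff hf).1 hS
    refine unitsMod_mono (fun x hx => ?_) hu
    rw [mem_oneSubIdeal (minSum_mul_self hf.1), minSum_mul_eq_zero_iff hf.1] at hx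
    exact (mem_oneSubIdeal (hi I)).2 (hx I hI)

theorem strongDen_eq [Nontrivial R] (hf : LiftsSimpleFactors f) :
    strongDen R = unitsMod (oneSubIdeal (minSum f) (minSum_mul hf.1)) := by
  refine le_antisymm (fun x hx => ?_) (le_sSup ⟨?_, (stronglyLocalizable_eq hf).ge⟩)
  · have := strongDen_subset hx
    rwa [stronglyLocalizable_eq hf] at this
  · exact isLeftDen_unitsMod _ (minSum_mul_self hf.1) hf.minSum_ne_zero

theorem mem_strongRadical_iff [Nontrivial R] (hf : LiftsSimpleFactors f) {x : R} :
    x ∈ strongRadical R ↔ minSum f * x = 0 := by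
  rw [← mem_ass_unitsMod (minSum_mul hf.1) (minSum_mul_self hf.1)
    (strongDen_eq hf ▸ isLeftDen_strongDen)]
  change (∃ s ∈ strongDen R, s * x = 0) ↔ ∃ s ∈ unitsMod _, s * x = 0
  rw [strongDen_eq hf]

end Classification

section MaxDen

variable {R : Type u} [Ring R] [IsArtinianRing R]

theorem toMaxLocProd_surjective : Function.Surjective (toMaxLocProd R) := by
  obtain ⟨s, f, hf⟩ := exists_liftsSimpleFactors (R := R)
  intro y
  choose x hx using fun S : maxDen R => toLocalization_surjective S.2.prop (y S)
  classical
  obtain ⟨r, hr⟩ := exists_idem_mul_sub_eq_zero hf.1 fun I =>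
    if hI : I ∈ minI f then x ⟨_, (mem_maxDen_iff hf).2 ⟨I, hI, rfl⟩⟩ else 0
  refine ⟨r, funext fun ⟨S, hS⟩ => ?_⟩
  obtain ⟨I, hI, rfl⟩ := (mem_maxDen_iff hf).1 hS
  rw [← hx]
  change toLocalization _ _ r = _
  rw [← sub_eq_zero, ← map_sub, toLocalization_eq_zero_iff,
    mem_ass_unitsMod _ (idem_mul_self hf.1 _)]
  simpa [hI] using hr I hI

theorem toMaxLocProd_eq_zero_iff [Nontrivial R] {x : R} :
    toMaxLocProd R x = 0 ↔ x ∈ strongRadical R := by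
  obtain ⟨s, f, hf⟩ := exists_liftsSimpleFactors (R := R)
  rw [mem_strongRadical_iff hf, ← mem_ass_maxDen_iff hf, funext_iff]
  exact forall_congr' fun S => toLocalization_eq_zero_iff S.2.prop

theorem localizationRadical_eq [Nontrivial R] :
    localizationRadical R = (strongRadical R : Set R) := by
  obtain ⟨s, f, hf⟩ := exists_liftsSimpleFactors (R := R)
  ext x
  rw [SetLike.mem_coe, mem_strongRadical_iff hf, ← mem_ass_maxDen_iff hf]
  exact Set.mem_iInter

theorem coe_strongDen_eq [Nontrivial R] : (strongDen R : Set R) = stronglyLocalizable R := by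
  obtain ⟨s, f, hf⟩ := exists_liftsSimpleFactors (R := R)
  rw [strongDen_eq hf, stronglyLocalizable_eq hf]

theorem mem_maxDen_of_isUnit {S : Submonoid R} (hS : S ∈ maxDen R) {u : R} (hu : IsUnit u) :
    u ∈ S := by
  obtain ⟨s, f, hf⟩ := exists_liftsSimpleFactors (R := R)
  obtain ⟨I, hI, rfl⟩ := (mem_maxDen_iff hf).1 hS
  exact mem_unitsMod_of_isUnit hu

/-- A maximal left denominator set `S` of a left Artinian ring is determined by `ass(S)`. -/
theorem maxDen_eq_of_ass_le {S T : Submonoid R} (hS : S ∈ maxDen R) (hT : T ∈ maxDen R)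
    (h : ass S hS.prop ≤ ass T hT.prop) : S = T := by
  refine hS.eq_of_le hT.prop ((le_unitsMod_ass hS.prop).trans ((unitsMod_mono h).trans ?_))
  obtain ⟨s, f, hf⟩ := exists_liftsSimpleFactors (R := R)
  obtain ⟨I, hI, rfl⟩ := (mem_maxDen_iff hf).1 hT
  refine unitsMod_mono fun x hx => ?_
  rwa [mem_oneSubIdeal (idem_mul_self hf.1 _), ← mem_ass_unitsMod _ (idem_mul_self hf.1 _) hT.prop]

end MaxDen

/-! ### Extension and contraction along a classical quotient ring -/

section Transfer

/-- Ore and denominator conditions need only be checked on generators. -/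
theorem isLeftDen_closure {R : Type u} [Ring R] {G : Set R} (h0 : (0 : R) ∉ Submonoid.closure G)
    (hore : ∀ g ∈ G, ∀ r : R, ∃ t ∈ Submonoid.closure G, ∃ q : R, t * r = q * g)
    (hden : ∀ g ∈ G, ∀ r : R, r * g = 0 → ∃ t ∈ Submonoid.closure G, t * r = 0) :
    IsLeftDen (Submonoid.closure G) := by
  refine ⟨⟨h0, fun r s hs => ?_⟩, fun r s hs => ?_⟩
  · induction hs using Submonoid.closure_induction generalizing r with
    | mem x hx => exact hore x hx r
    | one => exact ⟨1, one_mem _, r, by simp⟩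
    | mul x y _ _ ihx ihy =>
      obtain ⟨t, ht, q, hq⟩ := ihy r
      obtain ⟨t', ht', q', hq'⟩ := ihx q
      exact ⟨t' * t, mul_mem ht' ht, q', by rw [mul_assoc, hq, ← mul_assoc, hq', mul_assoc]⟩
  · induction hs using Submonoid.closure_induction generalizing r with
    | mem x hx => exact hden x hx r
    | one => exact fun h => ⟨1, one_mem _, by simpa using h⟩
    | mul x y _ _ ihx ihy =>
      intro h
      obtain ⟨t, ht, hq⟩ := ihy (r * x) (by rw [mul_assoc, h])
      obtain ⟨t', ht', hq'⟩ := ihx (t * r) (by rw [mul_assoc, hq])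
      exact ⟨t' * t, mul_mem ht' ht, by rw [mul_assoc, hq']⟩

/-- An injective homomorphism `σ : A → R` such that every element of `R` is a left fraction
`σ(c)⁻¹σ(a)`. -/
structure IsFractionEmbedding {A R : Type u} [Ring A] [Ring R] (σ : A →+* R) : Prop where
  injective : Function.Injective σ
  exists_frac : ∀ x, ∃ c a, IsUnit (σ c) ∧ σ c * x = σ a

theorem isFractionEmbedding_toClassicalQuot {A : Type u} [Ring A]
    (hA : IsLeftOre (nonZeroDivisors A)) : IsFractionEmbedding (toClassicalQuot A hA) where
  injective := (injective_iff_map_eq_zero _).2 fun r hr => by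
    obtain ⟨s, hs, h0⟩ := (toLocalization_eq_zero_iff _).1 hr
    exact hs.1 r h0
  exists_frac x := by
    obtain ⟨s, hs, b, hb⟩ := exists_toLocalization_mul_eq _ x
    exact ⟨s, b, isUnit_toLocalization _ hs, hb⟩

variable {A R : Type u} [Ring A] [Ring R] {σ : A →+* R}

theorem IsFractionEmbedding.exists_frac₂ (hσ : IsFractionEmbedding σ) (x y : R) :
    ∃ c a b, IsUnit (σ c) ∧ σ c * x = σ a ∧ σ c * y = σ b := by
  obtain ⟨c, a, hc, ha⟩ := hσ.exists_frac x
  obtain ⟨d, b, hd, hb⟩ := hσ.exists_frac (σ c * y)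
  exact ⟨d * c, d * a, b, by simpa using hd.mul hc, by simp [mul_assoc, ha],
    by simp [mul_assoc, hb]⟩

/-- The contraction to `A` of a left denominator set of `R` that contains all units is a left
denominator set. -/
theorem IsFractionEmbedding.isLeftDen_comap (hσ : IsFractionEmbedding σ) {S : Submonoid R}
    (h : IsLeftDen S) (hu : ∀ u, IsUnit u → u ∈ S) : IsLeftDen (S.comap σ) := by
  refine ⟨⟨fun h0 => h.1.1 (by simpa using h0), fun r s hs => ?_⟩, fun r s hs hrs => ?_⟩
  · obtain ⟨t, ht, q, hq⟩ := h.1.2 (σ r) (σ s) hs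
    obtain ⟨c, a, b, hc, ha, hb⟩ := hσ.exists_frac₂ t q
    refine ⟨a, ?_, b, hσ.injective ?_⟩
    · rw [Submonoid.mem_comap, ← ha]
      exact S.mul_mem (hu _ hc) ht
    · rw [map_mul, map_mul, ← ha, ← hb, mul_assoc, hq, mul_assoc]
  · obtain ⟨t, ht, h0⟩ := h.2 (σ r) (σ s) hs (by rw [← map_mul, hrs, map_zero])
    obtain ⟨c, a, hc, ha⟩ := hσ.exists_frac t
    refine ⟨a, ?_, hσ.injective ?_⟩
    · rw [Submonoid.mem_comap, ← ha]
      exact S.mul_mem (hu _ hc) ht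
    · rw [map_mul, ← ha, mul_assoc, h0, mul_zero, map_zero]

theorem IsFractionEmbedding.mem_ass_comap (hσ : IsFractionEmbedding σ) {S : Submonoid R}
    (h : IsLeftDen S) (hu : ∀ u, IsUnit u → u ∈ S) (h' : IsLeftDen (S.comap σ)) {x : A} :
    x ∈ ass (S.comap σ) h' ↔ σ x ∈ ass S h := by
  constructor
  · rintro ⟨s, hs, h0⟩
    exact ⟨σ s, hs, by rw [← map_mul, h0, map_zero]⟩
  · rintro ⟨t, ht, h0⟩
    obtain ⟨c, a, hc, ha⟩ := hσ.exists_frac t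
    refine ⟨a, ?_, hσ.injective ?_⟩
    · rw [Submonoid.mem_comap, ← ha]
      exact S.mul_mem (hu _ hc) ht
    · rw [map_mul, ← ha, mul_assoc, h0, mul_zero, map_zero]

/-- If `S` contains all units of `R`, then `(A ∩ S)⁻¹A ≅ S⁻¹R` over `A`. -/
theorem IsFractionEmbedding.isoOver_comap (hσ : IsFractionEmbedding σ) {S : Submonoid R}
    (h : IsLeftDen S) (hu : ∀ u, IsUnit u → u ∈ S) (h' : IsLeftDen (S.comap σ)) :
    IsoOver (toLocalization (S.comap σ) h') ((toLocalization S h).comp σ) := by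
  refine isoOver_toLocalization h' (fun s hs => isUnit_toLocalization h hs) (fun r => ?_)
    fun y => ?_
  · rw [hσ.mem_ass_comap h hu h']
    exact toLocalization_eq_zero_iff h
  · obtain ⟨s, hs, b, hb⟩ := exists_toLocalization_mul_eq h y
    obtain ⟨c, a, d, hc, ha, hd⟩ := hσ.exists_frac₂ s b
    refine ⟨a, ?_, d, ?_⟩
    · rw [Submonoid.mem_comap, ← ha]
      exact S.mul_mem (hu _ hc) hs
    · rw [RingHom.comp_apply, RingHom.comp_apply, ← ha, ← hd, map_mul, map_mul, mul_assoc, hb]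

/-- Every left denominator set `S'` of `A` is contained in the contraction of a left denominator set
of `R`, namely of the one generated by `S'` and the units of `R`. That `0` is not a product of such
generators holds because right multiplication by a generator does not enlarge the set of those
`x ∈ R` with `t c x = 0` for some `t ∈ S'` and some `c ∈ A` that is a unit of `R`; this set does not
contain `1`. -/
theorem IsFractionEmbedding.exists_le_comap [Nontrivial R] (hσ : IsFractionEmbedding σ)
    {S' : Submonoid A} (h' : IsLeftDen S') :
    ∃ S : Submonoid R, IsLeftDen S ∧ S' ≤ S.comap σ := by
  set G : Set R := σ '' S' ∪ {u | IsUnit u}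
  have hS' : ∀ s ∈ S', σ s ∈ Submonoid.closure G := fun s hs =>
    Submonoid.subset_closure (Or.inl ⟨s, hs, rfl⟩)
  have hunit : ∀ u, IsUnit u → u ∈ Submonoid.closure G := fun u hu =>
    Submonoid.subset_closure (Or.inr hu)
  let N : Set R := {x | ∃ t ∈ S', ∃ c, IsUnit (σ c) ∧ σ t * σ c * x = 0}
  have hN : ∀ p ∈ Submonoid.closure G, ∀ x, x * p ∈ N → x ∈ N := by
    intro p hp
    induction hp using Submonoid.closure_induction with
    | mem p hp =>
      rintro x ⟨t, ht, c, hc, h0⟩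
      rcases hp with ⟨s, hs, rfl⟩ | hu
      · obtain ⟨d, b, hd, hb⟩ := hσ.exists_frac (σ c * x)
        obtain ⟨t', ht', q, hq⟩ := h'.1.2 d t ht
        have key : σ t' * σ (d * c) * x = σ q * (σ t * σ c * x) := by
          calc σ t' * σ (d * c) * x = σ (t' * d) * σ c * x := by simp [mul_assoc]
            _ = _ := by rw [hq]; simp [mul_assoc]
        have key' : σ t' * σ (d * c) * x = σ (t' * b) := by
          rw [map_mul, map_mul, ← hb]; simp [mul_assoc]
        obtain ⟨t'', ht'', h1⟩ := h'.2 (t' * b) s hs <| hσ.injective <| by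
          rw [map_mul, ← key', key, mul_assoc, mul_assoc, h0, mul_zero, map_zero]
        refine ⟨t'' * t', S'.mul_mem ht'' ht', d * c, by simpa using hd.mul hc, ?_⟩
        rw [map_mul, mul_assoc, mul_assoc, ← mul_assoc (σ t'), key', ← map_mul, h1, map_zero]
      · rw [← mul_assoc] at h0
        exact ⟨t, ht, c, hc, (IsUnit.mul_left_eq_zero hu).1 h0⟩
    | one => exact fun x hx => by simpa using hx
    | mul p q _ _ ihp ihq => exact fun x hx => ihp x (ihq _ (by rwa [mul_assoc]))
  have h1N : (1 : R) ∉ N := by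
    rintro ⟨t, ht, c, hc, h0⟩
    rw [mul_one, hc.mul_left_eq_zero] at h0
    exact h'.1.1 ((hσ.injective (h0.trans (map_zero σ).symm)) ▸ ht)
  refine ⟨Submonoid.closure G, isLeftDen_closure (fun h0 => ?_) ?_ ?_, hS'⟩
  · exact h1N (hN 0 h0 1 ⟨1, one_mem _, 1, by simp, by simp⟩)
  · rintro g (⟨s, hs, rfl⟩ | hu) r
    · obtain ⟨c, a, hc, ha⟩ := hσ.exists_frac r
      obtain ⟨t, ht, q, hq⟩ := h'.1.2 a s hs
      refine ⟨σ t * σ c, mul_mem (hS' t ht) (hunit _ hc), σ q, ?_⟩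
      rw [mul_assoc, ha, ← map_mul, hq, map_mul]
    · obtain ⟨u, rfl⟩ := hu
      exact ⟨1, one_mem _, r * ↑u⁻¹, by simp⟩
  · rintro g (⟨s, hs, rfl⟩ | hu) r h0
    · obtain ⟨c, a, hc, ha⟩ := hσ.exists_frac r
      obtain ⟨t, ht, h1⟩ := h'.2 a s hs <| hσ.injective <| by
        rw [map_mul, ← ha, mul_assoc, h0, mul_zero, map_zero]
      refine ⟨σ t * σ c, mul_mem (hS' t ht) (hunit _ hc), ?_⟩
      rw [mul_assoc, ha, ← map_mul, h1, map_zero]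
    · exact ⟨1, one_mem _, by rw [one_mul]; exact (IsUnit.mul_left_eq_zero hu).1 h0⟩

theorem IsFractionEmbedding.exists_maxDen_le_comap [Nontrivial R] (hσ : IsFractionEmbedding σ)
    {S' : Submonoid A} (h' : IsLeftDen S') : ∃ S ∈ maxDen R, S' ≤ S.comap σ := by
  obtain ⟨S, hS, hle⟩ := hσ.exists_le_comap h'
  obtain ⟨M, hM, hSM⟩ := exists_le_maxDen hS
  exact ⟨M, hM, hle.trans (Submonoid.monotone_comap hSM)⟩

variable [IsArtinianRing R]

theorem IsFractionEmbedding.isLeftDen_comap_maxDen (hσ : IsFractionEmbedding σ) {S : Submonoid R}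
    (hS : S ∈ maxDen R) : IsLeftDen (S.comap σ) :=
  hσ.isLeftDen_comap hS.prop fun _ => mem_maxDen_of_isUnit hS

/-- A maximal left denominator set `S` of `R` is determined by its contraction, as every element of
`ass(S)` is a left fraction with numerator in `ass(A ∩ S)`. -/
theorem IsFractionEmbedding.eq_of_comap_le (hσ : IsFractionEmbedding σ) {S T : Submonoid R}
    (hS : S ∈ maxDen R) (hT : T ∈ maxDen R) (h : S.comap σ ≤ T.comap σ) : S = T := by
  refine maxDen_eq_of_ass_le hS hT fun x hx => ?_
  obtain ⟨c, a, hc, ha⟩ := hσ.exists_frac x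
  have h1 : a ∈ ass _ (hσ.isLeftDen_comap_maxDen hS) := by
    rw [hσ.mem_ass_comap hS.prop fun _ => mem_maxDen_of_isUnit hS, ← ha]
    exact Ideal.mul_mem_left _ _ hx
  have h2 : a ∈ ass _ (hσ.isLeftDen_comap_maxDen hT) := by
    obtain ⟨t, ht, h0⟩ := h1
    exact ⟨t, h ht, h0⟩
  rw [hσ.mem_ass_comap hT.prop fun _ => mem_maxDen_of_isUnit hT, ← ha] at h2
  obtain ⟨u, hu⟩ := hc
  have := Ideal.mul_mem_left _ (↑u⁻¹ : R) h2
  rwa [← hu, u.inv_mul_cancel_left] at this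

theorem IsFractionEmbedding.comap_mem_maxDen [Nontrivial R] (hσ : IsFractionEmbedding σ)
    {S : Submonoid R} (hS : S ∈ maxDen R) : S.comap σ ∈ maxDen A := by
  refine ⟨hσ.isLeftDen_comap_maxDen hS, fun T hT hle => ?_⟩
  obtain ⟨M, hM, hTM⟩ := hσ.exists_maxDen_le_comap hT
  obtain rfl := hσ.eq_of_comap_le hS hM (hle.trans hTM)
  exact hTM

/-- Contraction is a bijection between the maximal left denominator sets of `R` and of `A`. -/
noncomputable def IsFractionEmbedding.maxDenEquiv [Nontrivial R] (hσ : IsFractionEmbedding σ) :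
    maxDen R ≃ maxDen A :=
  Equiv.ofBijective (fun S => ⟨S.1.comap σ, hσ.comap_mem_maxDen S.2⟩)
    ⟨fun S T h => Subtype.ext (hσ.eq_of_comap_le S.2 T.2 (congrArg Subtype.val h).le),
      fun ⟨T, hT⟩ => by
        obtain ⟨M, hM, hTM⟩ := hσ.exists_maxDen_le_comap hT.prop
        exact ⟨⟨M, hM⟩, Subtype.ext (hT.eq_of_le (hσ.isLeftDen_comap_maxDen hM) hTM).symm⟩⟩

theorem IsFractionEmbedding.isoOver_toMaxLocProd [Nontrivial R] (hσ : IsFractionEmbedding σ) :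
    IsoOver ((toMaxLocProd R).comp σ) (toMaxLocProd A) := by
  choose φ hφ using fun S : maxDen R => (hσ.isoOver_comap S.2.prop
    (fun _ => mem_maxDen_of_isUnit S.2) (hσ.isLeftDen_comap_maxDen S.2)).symm
  let ψ : ((S : maxDen R) → LeftLocalization S.1 S.2.prop) ≃+*
      ((S : maxDen R) → LeftLocalization (hσ.maxDenEquiv S).1 (hσ.maxDenEquiv S).2.prop) :=
    RingEquiv.piCongrRight φ
  refine ⟨ψ.trans (RingEquiv.piCongrLeft
    (fun S : maxDen A => LeftLocalization S.1 S.2.prop) hσ.maxDenEquiv), fun r => funext fun T => ?_⟩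
  obtain ⟨S, rfl⟩ := hσ.maxDenEquiv.surjective T
  refine (Equiv.piCongrLeft_apply_apply
    (fun S : maxDen A => LeftLocalization S.1 S.2.prop) hσ.maxDenEquiv
    (ψ (((toMaxLocProd R).comp σ) r)) S).trans ?_
  exact hφ S r

theorem IsFractionEmbedding.stronglyLocalizable_eq_preimage [Nontrivial R]
    (hσ : IsFractionEmbedding σ) :
    stronglyLocalizable A = σ ⁻¹' stronglyLocalizable R := by
  ext x
  simp only [stronglyLocalizable, Set.mem_preimage, Set.mem_iInter₂]
  constructor
  · exact fun h S hS => h _ (hσ.comap_mem_maxDen hS)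
  · intro h T hT
    obtain ⟨⟨S, hS⟩, h1⟩ := hσ.maxDenEquiv.surjective ⟨T, hT⟩
    obtain rfl : S.comap σ = T := congrArg Subtype.val h1
    exact h S hS

theorem mem_strongDen_of_isUnit [Nontrivial R] {u : R} (hu : IsUnit u) : u ∈ strongDen R := by
  rw [← SetLike.mem_coe, coe_strongDen_eq]
  exact Set.mem_iInter₂.2 fun S hS => mem_maxDen_of_isUnit hS hu

theorem IsFractionEmbedding.strongDen_eq_comap [Nontrivial R] (hσ : IsFractionEmbedding σ) :
    strongDen A = (strongDen R).comap σ := by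
  have h : stronglyLocalizable A = (strongDen R).comap σ := by
    rw [hσ.stronglyLocalizable_eq_preimage, ← coe_strongDen_eq]
    rfl
  refine le_antisymm (fun x hx => ?_) (le_sSup ⟨?_, h.ge⟩)
  · rw [← SetLike.mem_coe, ← h]
    exact strongDen_subset hx
  · exact hσ.isLeftDen_comap isLeftDen_strongDen fun _ => mem_strongDen_of_isUnit

theorem IsFractionEmbedding.coe_strongRadical [Nontrivial A] [Nontrivial R]
    (hσ : IsFractionEmbedding σ) :
    (strongRadical A : Set A) = σ ⁻¹' (strongRadical R : Set R) := by
  ext x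
  rw [Set.mem_preimage, SetLike.mem_coe, SetLike.mem_coe, strongRadical, strongRadical,
    ← hσ.mem_ass_comap isLeftDen_strongDen (fun _ => mem_strongDen_of_isUnit)
      (hσ.strongDen_eq_comap ▸ isLeftDen_strongDen)]
  change (∃ s ∈ strongDen A, s * x = 0) ↔ ∃ s ∈ (strongDen R).comap σ, s * x = 0
  rw [hσ.strongDen_eq_comap]

theorem IsFractionEmbedding.isoOver_toStrongQuot [Nontrivial A] [Nontrivial R]
    (hσ : IsFractionEmbedding σ) :
    IsoOver (toStrongQuot A) ((toStrongQuot R).comp σ) := by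
  have key : ∀ (T : Submonoid A) (hT : IsLeftDen T), T = (strongDen R).comap σ →
      IsoOver (toLocalization T hT) ((toStrongQuot R).comp σ) := by
    rintro _ hT rfl
    exact hσ.isoOver_comap isLeftDen_strongDen (fun _ => mem_strongDen_of_isUnit) hT
  exact key _ _ hσ.strongDen_eq_comap

end Transfer

end StrongLoc

theorem mainTheorem8 {A : Type u} [Ring A] [Nontrivial A]
    (hA : StrongLoc.IsLeftOre (nonZeroDivisors A))
    (hArt : IsArtinianRing (StrongLoc.ClassicalQuot A hA)) :
    -- `T_l(A)` is the intersection of the maximal left denominator sets of `A`, and it is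
    -- the intersection with `A` of the maximal left denominator sets of `R = Q_{l,cl}(A)`
    ((StrongLoc.strongDen A : Set A) = ⋂ S ∈ StrongLoc.maxDen A, (S : Set A)) ∧
    ((StrongLoc.strongDen A : Set A) = StrongLoc.toClassicalQuot A hA ⁻¹'
      ⋂ S ∈ StrongLoc.maxDen (StrongLoc.ClassicalQuot A hA),
        (S : Set (StrongLoc.ClassicalQuot A hA))) ∧
    -- the strong left localization radical of `A`
    ((StrongLoc.strongRadical A : Set A) = StrongLoc.toClassicalQuot A hA ⁻¹'
      (StrongLoc.strongRadical (StrongLoc.ClassicalQuot A hA) :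
        Set (StrongLoc.ClassicalQuot A hA))) ∧
    ((StrongLoc.strongRadical A : Set A) = StrongLoc.toClassicalQuot A hA ⁻¹'
      StrongLoc.localizationRadical (StrongLoc.ClassicalQuot A hA)) ∧
    -- `Q_l^s(A) ≅ Q_l^s(R)`
    StrongLoc.IsoOver (StrongLoc.toStrongQuot A)
      ((StrongLoc.toStrongQuot (StrongLoc.ClassicalQuot A hA)).comp
        (StrongLoc.toClassicalQuot A hA)) ∧
    -- `Q_l^s(R) = R/𝔩^s_R`
    StrongLoc.IsoOver (StrongLoc.toStrongQuot (StrongLoc.ClassicalQuot A hA))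
      (Ideal.Quotient.mk (StrongLoc.strongRadical (StrongLoc.ClassicalQuot A hA))) ∧
    -- the product of the maximal left localizations of `R`, and of those of `A`
    StrongLoc.IsoOver
      (Ideal.Quotient.mk (StrongLoc.strongRadical (StrongLoc.ClassicalQuot A hA)))
      (StrongLoc.toMaxLocProd (StrongLoc.ClassicalQuot A hA)) ∧
    StrongLoc.IsoOver
      ((StrongLoc.toMaxLocProd (StrongLoc.ClassicalQuot A hA)).comp
        (StrongLoc.toClassicalQuot A hA))
      (StrongLoc.toMaxLocProd A) ∧
    -- the description through the idempotent `e`, for every choice of the lifts `1_i`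
    (∀ (s : ℕ) (f : Fin s → StrongLoc.ClassicalQuot A hA) (hf : StrongLoc.LiftsSimpleFactors f),
      ((StrongLoc.strongRadical A : Set A) = StrongLoc.toClassicalQuot A hA ⁻¹'
        {x | ∃ r, x = (1 - StrongLoc.minSum f) * r}) ∧
      StrongLoc.IsoOver
        (Ideal.Quotient.mk (StrongLoc.strongRadical (StrongLoc.ClassicalQuot A hA)))
        (Ideal.Quotient.mk
          (StrongLoc.oneSubIdeal (StrongLoc.minSum f) (StrongLoc.minSum_mul hf.1))) ∧
      StrongLoc.IsoOver
        (Ideal.Quotient.mk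
          (StrongLoc.oneSubIdeal (StrongLoc.minSum f) (StrongLoc.minSum_mul hf.1)))
        (StrongLoc.toMinProd f) ∧
      StrongLoc.IsoOver (StrongLoc.toMinProd f)
        (StrongLoc.toMaxLocProd (StrongLoc.ClassicalQuot A hA))) := by
  have hσ := StrongLoc.isFractionEmbedding_toClassicalQuot hA
  have hquot : ∀ r, StrongLoc.toStrongQuot (StrongLoc.ClassicalQuot A hA) r = 0 ↔
      Ideal.Quotient.mk (StrongLoc.strongRadical (StrongLoc.ClassicalQuot A hA)) r = 0 :=
    fun r => (StrongLoc.toLocalization_eq_zero_iff _).trans Ideal.Quotient.eq_zero_iff_mem.symm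
  have hprod : ∀ r, Ideal.Quotient.mk
      (StrongLoc.strongRadical (StrongLoc.ClassicalQuot A hA)) r = 0 ↔
      StrongLoc.toMaxLocProd (StrongLoc.ClassicalQuot A hA) r = 0 :=
    fun r => Ideal.Quotient.eq_zero_iff_mem.trans StrongLoc.toMaxLocProd_eq_zero_iff.symm
  have hden : (StrongLoc.strongDen A : Set A) = StrongLoc.toClassicalQuot A hA ⁻¹'
      StrongLoc.stronglyLocalizable (StrongLoc.ClassicalQuot A hA) := by
    rw [hσ.strongDen_eq_comap, ← StrongLoc.coe_strongDen_eq]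
    rfl
  refine ⟨hden.trans hσ.stronglyLocalizable_eq_preimage.symm, hden, hσ.coe_strongRadical,
    hσ.coe_strongRadical.trans (by rw [StrongLoc.localizationRadical_eq]),
    hσ.isoOver_toStrongQuot,
    StrongLoc.isoOver_of_surjective (StrongLoc.toLocalization_surjective _)
      Ideal.Quotient.mk_surjective hquot,
    StrongLoc.isoOver_of_surjective Ideal.Quotient.mk_surjective
      StrongLoc.toMaxLocProd_surjective hprod,
    hσ.isoOver_toMaxLocProd, fun s f hf => ?_⟩
  have hrad : ∀ r, Ideal.Quotient.mk
      (StrongLoc.strongRadical (StrongLoc.ClassicalQuot A hA)) r = 0 ↔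
      StrongLoc.minSum f * r = 0 :=
    fun r => Ideal.Quotient.eq_zero_iff_mem.trans (StrongLoc.mem_strongRadical_iff hf)
  have hsum : ∀ r, Ideal.Quotient.mk
      (StrongLoc.oneSubIdeal (StrongLoc.minSum f) (StrongLoc.minSum_mul hf.1)) r = 0 ↔
      StrongLoc.minSum f * r = 0 :=
    fun r => Ideal.Quotient.eq_zero_iff_mem.trans
      (StrongLoc.mem_oneSubIdeal (StrongLoc.minSum_mul_self hf.1))
  have hmin := fun r => StrongLoc.toMinProd_eq_zero_iff hf.1 (x := r)
  refine ⟨?_, StrongLoc.isoOver_of_surjective Ideal.Quotient.mk_surjective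
      Ideal.Quotient.mk_surjective fun r => (hrad r).trans (hsum r).symm,
    StrongLoc.isoOver_of_surjective Ideal.Quotient.mk_surjective
      (StrongLoc.toMinProd_surjective hf.1) fun r => (hsum r).trans (hmin r).symm,
    StrongLoc.isoOver_of_surjective (StrongLoc.toMinProd_surjective hf.1)
      StrongLoc.toMaxLocProd_surjective
      fun r => ((hmin r).trans (hrad r).symm).trans (hprod r)⟩
  rw [hσ.coe_strongRadical]
  congr 1
  ext x
  exact (StrongLoc.mem_strongRadical_iff hf).trans
    (StrongLoc.mem_oneSubIdeal (he := StrongLoc.minSum_mul hf.1)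
      (StrongLoc.minSum_mul_self hf.1)).symm
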